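/- Let $\mathcal H$ and $\mathcal H_i$ ($i\in N$, $N$ a finite set of shares) be finite-dimensional complex Hilbert spaces, and write $\mathcal H_X=\bigotimes_{i\in X}\mathcal H_i$ for $X\subseteq N$. Let $\mathcal S(\cdot)$ denote the set of density operators on a space, and call a completely positive trace-preserving map a quantum operation. A quantum operation $\mathcal E$ from $\mathcal J$ to $\mathcal K$ is *reversible* (with respect to $\mathcal S(\mathcal J)$) if there is a quantum operation $\mathcal R$ from $\mathcal K$ to $\mathcal J$ with $\mathcal R(\mathcal E(\rho))=\rho$ for all $\rho\in\mathcal S(\mathcal J)$, and *vanishing* if there is $\rho_0\in\mathcal S(\mathcal K)$ with $\mathcal E(\rho)=\rho_0$ for all $\rho\in\mathcal S(\mathcal J)$. A *quantum secret sharing (QSS) scheme* is a reversible quantum operation $W_N$ from $\mathcal H$ to $\mathcal H_N$. For $X\subseteq N$ let $W_X=\mathrm{Tr}_{N\setminus X}\circ W_N$; the set $X$ is *qualified* if $W_X$ is reversible, *forbidden* if $W_X$ is vanishing, and *significant* if there is a forbidden set $Y\subseteq N$ such that $X\cup Y$ is qualified. Then for every QSS scheme $W_N$ and every share $i\in N$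 such that $\{i\}$ is significant, $$\dim\mathcal H\le\dim\mathcal H_i.$$ -/

import Mathlib

/-!
Finite-dimensional Hilbert spaces are written in a fixed orthonormal basis: a finite type `d`
of basis labels stands for the Hilbert space `EuclideanSpace ℂ d`, and linear operators on it are
matrices `Matrix d d ℂ`.  The tensor product of the spaces labelled by `e i` (`i ∈ X`) has the
product basis, labelled by the functions `(i : X) → e i`.
-/

open scoped ComplexOrder

/-- Density operators: positive semidefinite operators of trace one. -/
def densityOperators (d : Type*) [Fintype d] : Set (Matrix d d ℂ) :=
  {ρ | ρ.PosSemidef ∧ ρ.trace = 1}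

/-- The amplification `id_k ⊗ Φ`: the map `Φ` applied to each block of a block matrix. -/
def amplify {d e : Type*} (k : ℕ) (Φ : Matrix d d ℂ →ₗ[ℂ] Matrix e e ℂ)
    (M : Matrix (Fin k × d) (Fin k × d) ℂ) : Matrix (Fin k × e) (Fin k × e) ℂ :=
  Matrix.of fun p q => Φ (Matrix.of fun a b => M (p.1, a) (q.1, b)) p.2 q.2

/-- Complete positivity: every amplification preserves positive semidefiniteness. -/
def IsCompletelyPositive {d e : Type*} (Φ : Matrix d d ℂ →ₗ[ℂ] Matrix e e ℂ) : Prop :=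
  ∀ (k : ℕ) (M : Matrix (Fin k × d) (Fin k × d) ℂ), M.PosSemidef → (amplify k Φ M).PosSemidef

/-- Quantum operations: completely positive trace-preserving maps. -/
structure QuantumOperation (d e : Type*) [Fintype d] [Fintype e] where
  toLin : Matrix d d ℂ →ₗ[ℂ] Matrix e e ℂ
  completelyPositive : IsCompletelyPositive toLin
  tracePreserving : ∀ ρ : Matrix d d ℂ, (toLin ρ).trace = ρ.trace

namespace QuantumOperation

/-- Composition: first `E`, then `F`. -/
def comp {d e f : Type*} [Fintype d] [Fintype e] [Fintype f]
    (F : QuantumOperation e f) (E : QuantumOperation d e) : QuantumOperation d f where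
  toLin := F.toLin ∘ₗ E.toLin
  completelyPositive := fun k M hM =>
    F.completelyPositive k _ (E.completelyPositive k M hM)
  tracePreserving := fun ρ => by
    rw [LinearMap.comp_apply, F.tracePreserving, E.tracePreserving]

/-- `E` is reversible with respect to a set `S` of states. -/
def IsReversible {d e : Type*} [Fintype d] [Fintype e] (E : QuantumOperation d e)
    (S : Set (Matrix d d ℂ)) : Prop :=
  ∃ R : QuantumOperation e d, ∀ ρ ∈ S, R.toLin (E.toLin ρ) = ρ

/-- `E` is vanishing with respect to a set `S` of states. -/
def IsVanishing {d e : Type*} [Fintype d] [Fintype e] (E : QuantumOperation d e)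
    (S : Set (Matrix d d ℂ)) : Prop :=
  ∃ ρ₀ ∈ densityOperators e, ∀ ρ ∈ S, E.toLin ρ = ρ₀

end QuantumOperation

/-- The basis label of the whole system which is `a` on the shares in `X` and `c` on the others. -/
def joinLabels {N : Type*} [DecidableEq N] {e : N → Type*} (X : Finset N)
    (a : (i : {i // i ∈ X}) → e i) (c : (i : {i // i ∉ X}) → e i) : (i : N) → e i :=
  (Equiv.piEquivPiSubtypeProd (fun i => i ∈ X) e).symm (a, c)

/-- The partial trace over the complement of `X`, as a linear map. -/
noncomputable def partialTraceLin {N : Type*} [Fintype N] [DecidableEq N] (e : N → Type*)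
    [∀ i, Fintype (e i)] (X : Finset N) :
    Matrix ((i : N) → e i) ((i : N) → e i) ℂ →ₗ[ℂ]
      Matrix ((i : {i // i ∈ X}) → e i) ((i : {i // i ∈ X}) → e i) ℂ where
  toFun ρ := Matrix.of fun a b =>
    ∑ c : (i : {i // i ∉ X}) → e i, ρ (joinLabels X a c) (joinLabels X b c)
  map_add' := fun ρ σ => by
    ext a b
    simp [Finset.sum_add_distrib]
  map_smul' := fun z ρ => by
    ext a b
    simp [Finset.mul_sum]

/-- The partial trace over the complement of `X`, as a quantum operation. -/
noncomputable def partialTrace {N : Type*} [Fintype N] [DecidableEq N] (e : N → Type*)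
    [∀ i, Fintype (e i)] (X : Finset N) :
    QuantumOperation ((i : N) → e i) ((i : {i // i ∈ X}) → e i) where
  toLin := partialTraceLin e X
  completelyPositive := fun k M hM => by
    have h : amplify k (partialTraceLin e X) M =
        ∑ c : (i : {i // i ∉ X}) → e i,
          M.submatrix (fun p : Fin k × ((i : {i // i ∈ X}) → e i) => (p.1, joinLabels X p.2 c))
            (fun p => (p.1, joinLabels X p.2 c)) := by
      ext p q
      simp [amplify, partialTraceLin, Matrix.sum_apply]
    rw [h]
    exact Matrix.posSemidef_sum _ fun c _ => hM.submatrix _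
  tracePreserving := fun ρ => by
    simp only [Matrix.trace, Matrix.diag, partialTraceLin, LinearMap.coe_mk, AddHom.coe_mk,
      Matrix.of_apply]
    rw [← Fintype.sum_prod_type']
    exact Equiv.sum_comp (Equiv.piEquivPiSubtypeProd (fun i => i ∈ X) e).symm
      (fun x => ρ x x)

/-- A quantum secret sharing scheme encrypting states of `EuclideanSpace ℂ d` into the shares
`EuclideanSpace ℂ (e i)`, `i : N`: an encoding quantum operation that is reversible with respect
to all density operators. -/
structure QSSScheme (d : Type*) [Fintype d] {N : Type*} [Fintype N] [DecidableEq N]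
    (e : N → Type*) [∀ i, Fintype (e i)] where
  encoder : QuantumOperation d ((i : N) → e i)
  reversible : encoder.IsReversible (densityOperators d)

namespace QSSScheme

/-- The encoder followed by the partial trace over the complement of `X`. -/
noncomputable def reduced {d : Type*} [Fintype d] {N : Type*} [Fintype N] [DecidableEq N]
    {e : N → Type*} [∀ i, Fintype (e i)] (W : QSSScheme d e) (X : Finset N) :
    QuantumOperation d ((i : {i // i ∈ X}) → e i) :=
  (partialTrace e X).comp W.encoder

/-- The shares in `X` together determine the secret state. -/
def IsQualified {d : Type*} [Fintype d] {N : Type*} [Fintype N] [DecidableEq N]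
    {e : N → Type*} [∀ i, Fintype (e i)] (W : QSSScheme d e) (X : Finset N) : Prop :=
  (W.reduced X).IsReversible (densityOperators d)

/-- The shares in `X` together carry no information about the secret state. -/
def IsForbidden {d : Type*} [Fintype d] {N : Type*} [Fintype N] [DecidableEq N]
    {e : N → Type*} [∀ i, Fintype (e i)] (W : QSSScheme d e) (X : Finset N) : Prop :=
  (W.reduced X).IsVanishing (densityOperators d)

/-- `X` is significant if it turns some forbidden set into a qualified one. -/
def IsSignificant {d : Type*} [Fintype d] {N : Type*} [Fintype N] [DecidableEq N]
    {e : N → Type*} [∀ i, Fintype (e i)] (W : QSSScheme d e) (X : Finset N) : Prop :=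
  ∃ Y : Finset N, W.IsForbidden Y ∧ W.IsQualified (X ∪ Y)

end QSSScheme

open Matrix Kronecker

/-! The proof is the entropy argument for secret sharing with ranks in place of entropies. Kraus
operators of the encoder, with the secret's input index `s` kept as a reference system, form a
four-index tensor `T y t z s`: `y` labels the forbidden set `Y`, `t` the share `i`, and `z` the
remaining shares together with the Kraus index (the environment). Since `Y` is forbidden, the
reduction of `T` to `y, s` is `σ ⊗ 1`. Since `{i} ∪ Y` is qualified, the Knill–Laflamme condition
makes the reduction to `z, s` equal to `τ ⊗ 1`.

The two sides of a bipartition of a pure tensor have equal rank, and the rank on `t, z` is at most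
`|t|` times the rank on `z`. Hence `|s| rank σ ≤ |t| rank τ`, and symmetrically `|s| rank τ ≤ |t|
rank σ`. Together these give `|s|² ≤ |t|²`, as `σ ≠ 0`. -/

/-! ### Rank inequalities for four-index tensors -/

theorem Matrix.exists_eq_mul_of_rank {m n : Type*} [Fintype m] [Fintype n] {K : Type*} [Field K]
    (A : Matrix m n K) :
    ∃ (P : Matrix m (Fin A.rank) K) (Q : Matrix (Fin A.rank) n K), A = P * Q := by
  classical
  let b := Module.finBasis K A.mulVecLin.range
  have hb : Module.finrank K A.mulVecLin.range = A.rank := rfl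
  rw [hb] at b
  refine ⟨of fun i r => (b r : m → K) i,
    of fun r j => b.repr ⟨A.mulVecLin (Pi.single j 1), LinearMap.mem_range_self _ _⟩ r, ?_⟩
  ext i j
  have h := b.sum_repr ⟨A.mulVecLin (Pi.single j 1), LinearMap.mem_range_self _ _⟩
  have h' := congrFun (congrArg Subtype.val h) i
  have hj : A.mulVecLin (Pi.single j 1) i = A i j := by simp
  rw [← hj]
  refine h'.symm.trans ?_
  simp only [Matrix.mul_apply, of_apply, Submodule.coe_sum, Submodule.coe_smul, Finset.sum_apply,
    Pi.smul_apply, smul_eq_mul, mul_comm]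

theorem Matrix.card_mul_rank_le_rank_one_kronecker {s y : Type*} [Fintype s] [Fintype y]
    [DecidableEq s] {K : Type*} [Field K] (σ : Matrix y y K) :
    Fintype.card s * σ.rank ≤ ((1 : Matrix s s K) ⊗ₖ σ).rank := by
  classical
  let g : (s → σ.mulVecLin.range) →ₗ[K] (s × y → K) :=
    { toFun := fun f p => (f p.1 : y → K) p.2
      map_add' := fun _ _ => rfl
      map_smul' := fun _ _ => rfl }
  have hg : Function.Injective g := by
    intro f f' h
    ext a b
    exact congrFun h (a, b)
  have hr : g.range ≤ ((1 : Matrix s s K) ⊗ₖ σ).mulVecLin.range := by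
    rintro _ ⟨f, rfl⟩
    choose u hu using fun a => (f a).2
    refine ⟨fun p => u p.1 p.2, ?_⟩
    ext ⟨a, b⟩
    have h := congrFun (hu a) b
    simp only [mulVecLin_apply, mulVec, dotProduct] at h ⊢
    rw [Fintype.sum_prod_type, Finset.sum_eq_single a]
    · simpa [g] using h
    · intro c _ hc
      simp [hc.symm]
    · simp
  calc Fintype.card s * σ.rank = Module.finrank K (s → σ.mulVecLin.range) := by
        rw [Module.finrank_pi_fintype]; simp [Matrix.rank]
    _ = Module.finrank K g.range := (LinearMap.finrank_range_of_inj hg).symm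
    _ ≤ _ := Submodule.finrank_mono hr

/-- If the tensor `T` has the reduction `1 ⊗ σ` on the indices `s, y`, then its flattening along
the index `z` has rank at least `card s * rank σ / card t`. -/
theorem card_mul_rank_le_of_reduction_eq {y t z s : Type*} [Fintype y] [Fintype t] [Fintype z]
    [Fintype s] [DecidableEq s] (T : y → t → z → s → ℂ) (σ : Matrix y y ℂ)
    (h : ∀ a a' c c', ∑ b, ∑ k, T a b k c * star (T a' b k c') =
      if c = c' then σ a a' else 0) :
    Fintype.card s * σ.rank ≤
      Fintype.card t * (Matrix.of fun (k : z) (p : y × t × s) => T p.1 p.2.1 k p.2.2).rank := by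
  classical
  obtain ⟨P, Q, hPQ⟩ := Matrix.exists_eq_mul_of_rank
    (Matrix.of fun (k : z) (p : y × t × s) => T p.1 p.2.1 k p.2.2)
  let r := (Matrix.of fun (k : z) (p : y × t × s) => T p.1 p.2.1 k p.2.2).rank
  let A : Matrix (s × y) (t × z) ℂ := of fun p q => T p.2 q.1 q.2 p.1
  have hA : (1 : Matrix s s ℂ) ⊗ₖ σ = A * Aᴴ := by
    ext ⟨c, a⟩ ⟨c', a'⟩
    have := h a a' c c'
    simp only [A, Matrix.mul_apply, conjTranspose_apply, of_apply, Fintype.sum_prod_type, this,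
      kroneckerMap_apply, Matrix.one_apply]
    split_ifs <;> simp
  -- Factoring the `z`-flattening through its rank `r` makes `A` factor through the index set `t ×
  -- Fin r`.
  let U : Matrix (s × y) (t × Fin r) ℂ := of fun p q => Q q.2 (p.2, q.1, p.1)
  have hU : A = U * ((1 : Matrix t t ℂ) ⊗ₖ Pᵀ) := by
    ext ⟨c, a⟩ ⟨b, k⟩
    have := congrFun (congrFun hPQ k) (a, b, c)
    simp only [of_apply, Matrix.mul_apply] at this
    simp only [A, U, of_apply, this, Matrix.mul_apply, Fintype.sum_prod_type, kroneckerMap_apply,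
      Matrix.one_apply, transpose_apply]
    rw [Finset.sum_eq_single b]
    · simp only [if_true, one_mul]
      exact Finset.sum_congr rfl fun _ _ => mul_comm _ _
    · intro b' _ hb; simp [hb]
    · simp
  calc Fintype.card s * σ.rank ≤ ((1 : Matrix s s ℂ) ⊗ₖ σ).rank :=
        Matrix.card_mul_rank_le_rank_one_kronecker σ
    _ = A.rank := by rw [hA, rank_self_mul_conjTranspose]
    _ ≤ U.rank := by rw [hU]; exact rank_mul_le_left _ _
    _ ≤ Fintype.card (t × Fin r) := rank_le_card_width _
    _ = Fintype.card t * r := by simp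

/-- Tracing out `s` as well turns the Gram matrix of the flattening into `card s • σ`, a nonzero
multiple of `σ` because `s` is nonempty. -/
theorem rank_flattening_eq {y t z s : Type*} [Fintype y] [Fintype t] [Fintype z]
    [Fintype s] [DecidableEq s] [Nonempty s] (T : y → t → z → s → ℂ) (σ : Matrix y y ℂ)
    (h : ∀ a a' c c', ∑ b, ∑ k, T a b k c * star (T a' b k c') =
      if c = c' then σ a a' else 0) :
    (Matrix.of fun (a : y) (p : z × t × s) => T a p.2.1 p.1 p.2.2).rank = σ.rank := by
  rw [← rank_self_mul_conjTranspose]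
  have h2 : (Matrix.of fun (a : y) (p : z × t × s) => T a p.2.1 p.1 p.2.2) *
      (Matrix.of fun (a : y) (p : z × t × s) => T a p.2.1 p.1 p.2.2)ᴴ =
      (Fintype.card s : ℂ) • σ := by
    ext a a'
    have hc : ∀ c, ∑ k, ∑ b, T a b k c * star (T a' b k c) = σ a a' := fun c => by
      rw [Finset.sum_comm, h, if_pos rfl]
    calc _ = ∑ k, ∑ b, ∑ c, T a b k c * star (T a' b k c) := by
          simp [Matrix.mul_apply, Fintype.sum_prod_type]
      _ = ∑ c, ∑ k, ∑ b, T a b k c * star (T a' b k c) := by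
          rw [Finset.sum_comm (s := Finset.univ (α := s))]
          exact Finset.sum_congr rfl fun k _ => Finset.sum_comm
      _ = _ := by simp only [hc]; simp
  classical
  rw [h2]
  refine le_antisymm ?_ ?_
  · rw [Matrix.smul_eq_diagonal_mul]
    exact rank_mul_le_right _ _
  · have hc : (Fintype.card s : ℂ) ≠ 0 := by simp
    have : σ = diagonal (fun _ => (Fintype.card s : ℂ)⁻¹) * ((Fintype.card s : ℂ) • σ) := by
      rw [← Matrix.smul_eq_diagonal_mul, smul_smul, inv_mul_cancel₀ hc, one_smul]
    conv_lhs => rw [this]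
    exact rank_mul_le_right _ _

theorem card_le_card_of_reductions_eq {y t z s : Type*} [Fintype y] [Fintype t] [Fintype z]
    [Fintype s] [DecidableEq s] (T : y → t → z → s → ℂ) (σ : Matrix y y ℂ) (τ : Matrix z z ℂ)
    (hσ : ∀ a a' c c', ∑ b, ∑ k, T a b k c * star (T a' b k c') =
      if c = c' then σ a a' else 0)
    (hτ : ∀ k k' c c', ∑ b, ∑ a, T a b k c * star (T a b k' c') =
      if c = c' then τ k k' else 0)
    (h0 : σ ≠ 0) : Fintype.card s ≤ Fintype.card t := by
  cases isEmpty_or_nonempty s with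
  | inl _ => simp
  | inr hs =>
    have h1 := card_mul_rank_le_of_reduction_eq T σ hσ
    have h2 := card_mul_rank_le_of_reduction_eq (fun k b a c => T a b k c) τ hτ
    rw [rank_flattening_eq (fun k b a c => T a b k c) τ hτ] at h1
    rw [rank_flattening_eq T σ hσ] at h2
    have hpos : 0 < σ.rank := by
      rw [Nat.pos_iff_ne_zero]
      intro h
      rw [Matrix.rank, Submodule.finrank_eq_zero, LinearMap.range_eq_bot] at h
      classical
      exact h0 ((Matrix.toLin' (R := ℂ)).injective (by rw [map_zero]; exact h))
    have h3 : Fintype.card s * Fintype.card s * σ.rank ≤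
        Fintype.card t * Fintype.card t * σ.rank := by
      calc Fintype.card s * Fintype.card s * σ.rank
          = Fintype.card s * (Fintype.card s * σ.rank) := by ring
        _ ≤ Fintype.card s * (Fintype.card t * τ.rank) := by gcongr
        _ = Fintype.card t * (Fintype.card s * τ.rank) := by ring
        _ ≤ Fintype.card t * (Fintype.card t * σ.rank) := by gcongr
        _ = _ := by ring
    exact Nat.mul_self_le_mul_self_iff.mp (Nat.le_of_mul_le_mul_right h3 hpos)

/-! ### Kraus operators and the Knill–Laflamme condition -/

theorem IsCompletelyPositive.exists_kraus {d e : Type*} [Fintype d] [Fintype e]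
    {Φ : Matrix d d ℂ →ₗ[ℂ] Matrix e e ℂ} (hΦ : IsCompletelyPositive Φ) :
    ∃ (n : ℕ) (K : Fin n → Matrix e d ℂ), ∀ M, Φ M = ∑ α, K α * M * (K α)ᴴ := by
  classical
  let f := Fintype.equivFin d
  -- The unnormalised maximally entangled vector: amplifying its rank-one projector gives the Choi
  -- matrix of `Φ`, whose rank-one decomposition yields the Kraus operators.
  let w : Fin (Fintype.card d) × d → ℂ := fun p => if f.symm p.1 = p.2 then 1 else 0
  have hpsd := hΦ _ _ (posSemidef_vecMulVec_self_star w)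
  have hblock : ∀ p q, amplify _ Φ (vecMulVec w (star w)) p q =
      Φ (single (f.symm p.1) (f.symm q.1) 1) p.2 q.2 := by
    intro p q
    simp only [amplify, of_apply]
    refine congrFun (congrFun (congrArg Φ (Matrix.ext fun a b => ?_)) _) _
    simp only [of_apply, vecMulVec_apply, Pi.star_apply, w, single_apply]
    split_ifs <;> simp_all
  obtain ⟨n, B, hB⟩ := posSemidef_iff_eq_sum_vecMulVec.mp hpsd
  have hentry : ∀ a b x y, Φ (single a b 1) x y = ∑ α, B α (f a, x) * star (B α (f b, y)) := by
    intro a b x y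
    have := hblock (f a, x) (f b, y)
    simp only [Equiv.symm_apply_apply] at this
    rw [← this, hB]
    simp [Matrix.sum_apply, vecMulVec_apply]
  refine ⟨n, fun α => of fun x a => B α (f a, x), fun M => ?_⟩
  have hM : M = ∑ a, ∑ b, M a b • single a b (1 : ℂ) := by
    refine (matrix_eq_sum_single M).trans ?_
    refine Finset.sum_congr rfl fun a _ => Finset.sum_congr rfl fun b _ => ?_
    rw [smul_single, smul_eq_mul, mul_one]
  have hΦM : Φ M = ∑ a, ∑ b, M a b • Φ (single a b (1 : ℂ)) := by
    refine (congrArg Φ hM).trans ?_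
    simp only [map_sum, map_smul]
  ext x y
  rw [hΦM]
  simp only [Matrix.sum_apply, Matrix.smul_apply, hentry, smul_eq_mul,
    Matrix.mul_apply, of_apply, conjTranspose_apply, Finset.sum_mul, Finset.mul_sum]
  rw [Finset.sum_comm]
  simp_rw [Finset.sum_comm (s := (Finset.univ : Finset d))
    (t := (Finset.univ : Finset (Fin n)))]
  refine Finset.sum_congr rfl fun α _ => Finset.sum_congr rfl fun b _ =>
    Finset.sum_congr rfl fun a _ => ?_
  ring

theorem LinearMap.eq_zero_of_forall_vecMulVec {d V : Type*} [Fintype d] [AddCommGroup V]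
    [Module ℂ V] (f : Matrix d d ℂ →ₗ[ℂ] V) (h : ∀ v, f (vecMulVec v (star v)) = 0) : f = 0 := by
  classical
  have key : ∀ u v, f (vecMulVec u (star v)) = 0 := by
    intro u v
    have h1 := h (u + v)
    -- Polarization: `u + v` makes the two cross terms opposite, while `u + I • v` makes them equal,
    -- so both vanish.
    have h2 := h (u + Complex.I • v)
    simp only [star_add, star_smul, add_vecMulVec, vecMulVec_add, smul_vecMulVec, vecMulVec_smul,
      map_add, map_smul, h, smul_zero, add_zero, zero_add] at h1 h2
    have h3 : f (vecMulVec v (star u)) = - f (vecMulVec u (star v)) := by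
      rw [eq_neg_iff_add_eq_zero, ← h1]
    rw [h3] at h2
    have h4 : (2 * Complex.I) • f (vecMulVec u (star v)) = 0 := by
      rw [← neg_eq_zero, ← h2]
      simp only [Complex.star_def, Complex.conj_I, two_mul, add_smul, neg_smul, smul_neg]
      abel
    exact (smul_eq_zero.mp h4).resolve_left (by simp)
  refine Matrix.ext_linearMap _ fun a b => LinearMap.ext_ring ?_
  have := key (Pi.single a 1) (Pi.single b 1)
  rw [← Pi.single_star, star_one, ← Matrix.single_eq_single_vecMulVec_single] at this
  simpa using this

theorem LinearMap.ext_densityOperators {d V : Type*} [Fintype d] [AddCommGroup V] [Module ℂ V]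
    {f g : Matrix d d ℂ →ₗ[ℂ] V} (h : ∀ ρ ∈ densityOperators d, f ρ = g ρ) : f = g := by
  rw [← sub_eq_zero]
  refine LinearMap.eq_zero_of_forall_vecMulVec _ fun v => ?_
  by_cases hv : v = 0
  · simp [hv]
  have ht : v ⬝ᵥ star v ≠ 0 := by simpa using hv
  have hnn : 0 ≤ v ⬝ᵥ star v := by simp
  have hρ : (v ⬝ᵥ star v)⁻¹ • vecMulVec v (star v) ∈ densityOperators d := by
    refine ⟨(posSemidef_vecMulVec_self_star v).smul (inv_nonneg_of_nonneg hnn), ?_⟩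
    rw [trace_smul, trace_vecMulVec, smul_eq_mul, inv_mul_cancel₀ ht]
  have := h _ hρ
  rw [map_smul, map_smul] at this
  rw [LinearMap.sub_apply, sub_eq_zero]
  exact smul_right_injective _ (inv_ne_zero ht) this

/-- Evaluating on matrix units gives all inner products of the vectors `γ ↦ F γ x a`. Off-diagonal
vectors, and differences of two diagonal ones, have norm zero. -/
theorem exists_eq_smul_one_of_sum_conj_eq {d κ : Type*} [Fintype d] [DecidableEq d] [Fintype κ]
    (F : κ → Matrix d d ℂ) (h : ∀ M, ∑ γ, F γ * M * (F γ)ᴴ = M) (γ : κ) :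
    ∃ c : ℂ, F γ = c • 1 := by
  have hent : ∀ x y a b, ∑ γ, F γ x a * star (F γ y b) = if a = x ∧ b = y then 1 else 0 := by
    intro x y a b
    have := congrFun (congrFun (h (single a b 1)) x) y
    rw [single_apply, Matrix.sum_apply] at this
    rw [← this]
    refine Finset.sum_congr rfl fun γ _ => ?_
    simp [Matrix.mul_apply, single_apply, ite_and]
  have hsq : ∀ g : κ → ℂ, ∑ γ, g γ * star (g γ) = 0 → ∀ γ, g γ = 0 := by
    intro g hg
    exact congrFun (dotProduct_self_star_eq_zero.mp hg)
  have hoff : ∀ x a, a ≠ x → F γ x a = 0 := fun x a hxa =>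
    hsq (fun γ => F γ x a) (by rw [hent]; simp [hxa]) γ
  have hdiag : ∀ x y, F γ x x = F γ y y := fun x y => by
    refine sub_eq_zero.mp (hsq (fun γ => F γ x x - F γ y y) ?_ γ)
    simp only [star_sub, sub_mul, mul_sub, Finset.sum_sub_distrib, hent]
    simp
  cases isEmpty_or_nonempty d with
  | inl _ => exact ⟨0, Subsingleton.elim _ _⟩
  | inr hd =>
    obtain ⟨x₀⟩ := hd
    refine ⟨F γ x₀ x₀, ?_⟩
    ext x a
    by_cases hxa : a = x
    · subst hxa; simp [hdiag a x₀]
    · simp [hoff x a hxa, Ne.symm hxa]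

/-- The Knill–Laflamme condition for the Kraus operators `E` of a correctable operation. -/
theorem QuantumOperation.exists_conjTranspose_mul_eq_smul_one {d e κ : Type*} [Fintype d]
    [DecidableEq d] [Fintype e] [Fintype κ] (R : QuantumOperation e d) (E : κ → Matrix e d ℂ)
    (h : ∀ M, R.toLin (∑ α, E α * M * (E α)ᴴ) = M) (α β : κ) :
    ∃ c : ℂ, (E β)ᴴ * E α = c • 1 := by
  classical
  obtain ⟨n, K, hK⟩ := R.completelyPositive.exists_kraus
  -- Trace preservation, read through the trace pairing.
  have hone : ∑ γ, (K γ)ᴴ * K γ = 1 := by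
    refine ext_iff_trace_mul_right.mpr fun M => ?_
    rw [one_mul, ← R.tracePreserving M, hK, Finset.sum_mul, trace_sum, trace_sum]
    refine Finset.sum_congr rfl fun γ _ => ?_
    rw [Matrix.mul_assoc, trace_mul_comm]
  -- The products `K γ * E α` are Kraus operators of the identity map, hence scalars.
  have hF := exists_eq_smul_one_of_sum_conj_eq (fun p : _ × κ => K p.1 * E p.2) fun M => by
    conv_rhs => rw [← h M, hK]
    rw [Fintype.sum_prod_type]
    refine Finset.sum_congr rfl fun γ _ => ?_
    rw [Matrix.mul_sum, Matrix.sum_mul]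
    simp [Matrix.mul_assoc]
  choose c hc using hF
  refine ⟨∑ γ, star (c (γ, β)) * c (γ, α), ?_⟩
  calc (E β)ᴴ * E α = (E β)ᴴ * (∑ γ, (K γ)ᴴ * K γ) * E α := by rw [hone, Matrix.mul_one]
    _ = ∑ γ, (K γ * E β)ᴴ * (K γ * E α) := by
      rw [Matrix.mul_sum, Matrix.sum_mul]
      simp [Matrix.mul_assoc]
    _ = _ := by
      rw [Finset.sum_smul]
      refine Finset.sum_congr rfl fun γ _ => ?_
      rw [hc (γ, β), hc (γ, α)]
      simp [smul_smul, mul_comm]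

/-! ### Splitting the labels of the shares among `Y`, `i` and the rest -/

section Labels

variable {N : Type*} [DecidableEq N] {e : N → Type*}

theorem joinLabels_apply (X : Finset N) (a : (i : {i // i ∈ X}) → e i)
    (c : (i : {i // i ∉ X}) → e i) (j : N) :
    joinLabels X a c j = if h : j ∈ X then a ⟨j, h⟩ else c ⟨j, h⟩ := rfl

/-- Labels of the shares in `{i} ∪ Y` as pairs of a label of `Y` and a label of `i`. -/
def insertLabelsEquiv (Y : Finset N) (i : N) (hi : i ∉ Y) :
    ((j : {j // j ∈ Y}) → e j) × e i ≃ ((j : {j // j ∈ ({i} ∪ Y : Finset N)}) → e j) where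
  toFun p j := if h : j.1 = i then cast (congrArg e h.symm) p.2 else
    p.1 ⟨j.1, (Finset.mem_union.mp j.2).resolve_left fun hj => h (Finset.mem_singleton.mp hj)⟩
  invFun f := (fun j => f ⟨j.1, Finset.mem_union_right _ j.2⟩,
    f ⟨i, Finset.mem_union_left _ (Finset.mem_singleton_self i)⟩)
  left_inv p := by
    refine Prod.ext (funext fun j => ?_) (by simp)
    have : j.1 ≠ i := fun h => hi (h ▸ j.2)
    simp [this]
  right_inv f := by
    funext ⟨j, hj⟩
    by_cases h : j = i
    · subst h; simp
    · simp [h]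

/-- Labels of the shares outside `Y` as pairs of a label of `i` and a label of the shares outside
`{i} ∪ Y`. -/
def complLabelsEquiv (Y : Finset N) (i : N) (hi : i ∉ Y) :
    e i × ((j : {j // j ∉ ({i} ∪ Y : Finset N)}) → e j) ≃ ((j : {j // j ∉ Y}) → e j) where
  toFun p j := if h : j.1 = i then cast (congrArg e h.symm) p.1 else
    p.2 ⟨j.1, by simp [h, j.2]⟩
  invFun f := (f ⟨i, hi⟩, fun j => f ⟨j.1, fun h => j.2 (Finset.mem_union_right _ h)⟩)
  left_inv p := by
    refine Prod.ext (by simp) (funext fun j => ?_)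
    exact dif_neg fun h : j.1 = i => j.2 (by simp [h])
  right_inv f := by
    funext ⟨j, hj⟩
    by_cases h : j = i
    · subst h; simp
    · simp [h]

theorem joinLabels_complLabelsEquiv (Y : Finset N) (i : N) (hi : i ∉ Y)
    (y : (j : {j // j ∈ Y}) → e j) (t : e i)
    (r : (j : {j // j ∉ ({i} ∪ Y : Finset N)}) → e j) :
    joinLabels Y y (complLabelsEquiv Y i hi (t, r)) =
      joinLabels ({i} ∪ Y) (insertLabelsEquiv Y i hi (y, t)) r := by
  funext j
  simp only [joinLabels_apply, complLabelsEquiv, insertLabelsEquiv, Equiv.coe_fn_mk]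
  by_cases h : j = i
  · subst h
    simp [hi]
  · by_cases hj : j ∈ Y <;> simp [h, hj]

end Labels

/-! ### Forbidden and qualified sets of a scheme -/

theorem partialTraceLin_mul_mul_conjTranspose {N : Type*} [Fintype N] [DecidableEq N]
    {e : N → Type*} [∀ i, Fintype (e i)] {d : Type*} [Fintype d] (X : Finset N)
    (K : Matrix ((i : N) → e i) d ℂ) (M : Matrix d d ℂ) :
    partialTraceLin e X (K * M * Kᴴ) = ∑ c : (i : {i // i ∉ X}) → e i,
      (of fun p s => K (joinLabels X p c) s) * M * (of fun p s => K (joinLabels X p c) s)ᴴ := by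
  ext a b
  simp [partialTraceLin, Matrix.sum_apply, Matrix.mul_apply]

theorem QuantumOperation.IsVanishing.toLin_apply {d e : Type*} [Fintype d] [Fintype e]
    {E : QuantumOperation d e} (h : E.IsVanishing (densityOperators d)) :
    ∃ ρ₀ ∈ densityOperators e, ∀ M, E.toLin M = M.trace • ρ₀ := by
  obtain ⟨ρ₀, h₀, h⟩ := h
  refine ⟨ρ₀, h₀, fun M => ?_⟩
  have : E.toLin = (traceLinearMap d ℂ ℂ).smulRight ρ₀ :=
    LinearMap.ext_densityOperators fun ρ hρ => by simp [h ρ hρ, hρ.2]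
  simp [this]

theorem QuantumOperation.IsReversible.toLin_apply {d e : Type*} [Fintype d] [Fintype e]
    {E : QuantumOperation d e} (h : E.IsReversible (densityOperators d)) :
    ∃ R : QuantumOperation e d, ∀ M, R.toLin (E.toLin M) = M := by
  obtain ⟨R, h⟩ := h
  have : R.toLin ∘ₗ E.toLin = LinearMap.id := LinearMap.ext_densityOperators h
  exact ⟨R, fun M => LinearMap.congr_fun this M⟩

theorem QuantumOperation.subsingleton_of_isReversible_of_isVanishing {d e : Type*} [Fintype d]
    [Fintype e] {E : QuantumOperation d e} (hr : E.IsReversible (densityOperators d))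
    (hv : E.IsVanishing (densityOperators d)) : Subsingleton d := by
  classical
  obtain ⟨ρ₀, -, hv⟩ := hv.toLin_apply
  obtain ⟨R, hR⟩ := hr.toLin_apply
  refine ⟨fun a b => ?_⟩
  have h : ∀ a : d, R.toLin ρ₀ = single a a 1 := fun a => by
    have := hR (single a a 1)
    rwa [hv, trace_single_eq_same, one_smul] at this
  by_contra hab
  have := congrFun (congrFun ((h a).symm.trans (h b)) a) a
  simp [Ne.symm hab] at this

/-- An empty share would make the whole output space zero, so the encoder could not preserve the
trace of a state. -/
theorem QSSScheme.nonempty_share {d : Type*} [Fintype d] [Nonempty d] {N : Type*} [Fintype N]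
    [DecidableEq N] {e : N → Type*} [∀ i, Fintype (e i)] (W : QSSScheme d e) (i : N) :
    Nonempty (e i) := by
  classical
  by_contra h
  rw [not_nonempty_iff] at h
  have : IsEmpty ((i : N) → e i) := ⟨fun f => h.elim (f i)⟩
  obtain ⟨a⟩ := ‹Nonempty d›
  have := W.encoder.tracePreserving (single a a 1)
  simp [Matrix.trace] at this

theorem QSSScheme.card_le_card_of_isForbidden_of_isQualified {d : Type*} [Fintype d]
    {N : Type*} [Fintype N] [DecidableEq N] {e : N → Type*} [∀ i, Fintype (e i)]
    (W : QSSScheme d e) {Y : Finset N} {i : N} (hi : i ∉ Y) (hY : W.IsForbidden Y)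
    (hQ : W.IsQualified ({i} ∪ Y)) : Fintype.card d ≤ Fintype.card (e i) := by
  classical
  obtain ⟨n, V, hV⟩ := W.encoder.completelyPositive.exists_kraus
  obtain ⟨σ, hσ, hF⟩ := hY.toLin_apply
  obtain ⟨R, hR⟩ := hQ.toLin_apply
  have hred : ∀ (X : Finset N) M, (W.reduced X).toLin M =
      ∑ p : ((j : {j // j ∉ X}) → e j) × Fin n,
        (of fun x s => V p.2 (joinLabels X x p.1) s) * M *
          (of fun x s => V p.2 (joinLabels X x p.1) s)ᴴ := by
    intro X M
    rw [Fintype.sum_prod_type, Finset.sum_comm]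
    change partialTraceLin e X (W.encoder.toLin M) = _
    rw [hV, map_sum]
    exact Finset.sum_congr rfl fun α _ => partialTraceLin_mul_mul_conjTranspose X (V α) M
  -- The Knill–Laflamme scalars of the recoverable reduction are the entries of the state `τ` of the
  -- complement and environment.
  choose τ hτ using fun p q => R.exists_conjTranspose_mul_eq_smul_one _
    (fun M => by rw [← hred]; exact hR M) p q
  refine card_le_card_of_reductions_eq
    (fun (y : (j : {j // j ∈ Y}) → e j) (t : e i)
      (z : ((j : {j // j ∉ ({i} ∪ Y : Finset N)}) → e j) × Fin n) s =>
        V z.2 (joinLabels ({i} ∪ Y) (insertLabelsEquiv Y i hi (y, t)) z.1) s) σ (of τ) ?_ ?_ ?_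
  · intro a a' c c'
    have h := congrFun (congrFun ((hred Y (single c c' 1)).symm.trans (hF _)) a) a'
    rw [Fintype.sum_prod_type, ← (complLabelsEquiv Y i hi).sum_comp, Fintype.sum_prod_type] at h
    simp only [joinLabels_complLabelsEquiv, Matrix.sum_apply] at h
    simp only [Fintype.sum_prod_type]
    have h' : (single c c' (1 : ℂ)).trace • σ a a' = if c = c' then σ a a' else 0 := by
      split_ifs with hc
      · subst hc; simp
      · simp [trace_single_eq_of_ne _ _ _ hc]
    rw [← h']
    refine Eq.trans ?_ h
    refine Finset.sum_congr rfl fun _ _ => Finset.sum_congr rfl fun _ _ =>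
      Finset.sum_congr rfl fun _ _ => ?_
    simp [Matrix.mul_apply, single_apply, ite_and]
  · intro k k' c c'
    have h := congrFun (congrFun (hτ k k') c') c
    simp only [Matrix.mul_apply, conjTranspose_apply, of_apply] at h
    rw [← (insertLabelsEquiv Y i hi).sum_comp, Fintype.sum_prod_type, Finset.sum_comm] at h
    simp only [mul_comm (star _)] at h
    rw [h]
    simp only [Matrix.smul_apply, Matrix.one_apply, of_apply, eq_comm (a := c), smul_eq_mul,
      mul_ite, mul_one, mul_zero]
  · rintro rfl
    simpa using hσ.2

theorem corollary1 {d : Type*} [Fintype d] {N : Type*} [Fintype N] [DecidableEq N]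
    {e : N → Type*} [∀ i, Fintype (e i)] (W : QSSScheme d e) (i : N)
    (hi : W.IsSignificant {i}) :
    Module.finrank ℂ (EuclideanSpace ℂ d) ≤ Module.finrank ℂ (EuclideanSpace ℂ (e i)) := by
  rw [finrank_euclideanSpace, finrank_euclideanSpace]
  obtain ⟨Y, hY, hQ⟩ := hi
  by_cases hiY : i ∈ Y
  -- Here `Y` is both qualified and forbidden, so the secret space has dimension at most one.
  · rw [Finset.union_eq_right.mpr (Finset.singleton_subset_iff.mpr hiY)] at hQ
    have := QuantumOperation.subsingleton_of_isReversible_of_isVanishing hQ hY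
    cases isEmpty_or_nonempty d with
    | inl _ => simp
    | inr _ =>
      have := W.nonempty_share i
      exact Fintype.card_le_one_iff_subsingleton.mpr ‹_› |>.trans Fintype.card_pos
  · exact W.card_le_card_of_isForbidden_of_isQualified hiY hY hQ
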